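/- **Setting.** Let $\mathfrak S$ be a finite set of heights with a symmetric adjacency relation (a graph; loops allowed). For a face with heights $d$ (top left), $c$ (top right), $a$ (bottom left), $b$ (bottom right) and $u\in\mathbb C$ let $W\left(\begin{smallmatrix}d&c\\a&b\end{smallmatrix}\middle|u\right)\in\mathbb C$ be Boltzmann weights, vanishing unless $d\sim c$, $d\sim a$, $a\sim b$, $c\sim b$. Let $\lambda\in\mathbb C$ and $\rho:\mathbb C\to\mathbb C$ with $\rho(0)^2=1$, and assume, for all heights and all $u,v\in\mathbb C$, * Yang–Baxter equation: $\sum_{g}W\left(\begin{smallmatrix}f&g\\a&b\end{smallmatrix}\middle|u-v\right)W\left(\begin{smallmatrix}f&e\\g&d\end{smallmatrix}\middle|v\right)W\left(\begin{smallmatrix}g&d\\b&c\end{smallmatrix}\middle|u\right)=\sum_{g}W\left(\begin{smallmatrix}f&e\\a&g\end{smallmatrix}\middle|u\right)W\left(\begin{smallmatrix}a&g\\b&c\end{smallmatrix}\middle|v\right)W\left(\begin{smallmatrix}e&d\\g&c\end{smallmatrix}\middle|u-v\right)$; * unitarity: $\sum_{e}W\left(\begin{smallmatrix}d&e\\a&b\end{smallmatrix}\middle|u\right)W\left(\begin{smallmatrix}d&c\\e&b\end{smallmatrix}\middle|-u\right)=\rho(u)\rho(-u)\,\delta_{ac}$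 for $d\sim a\sim b$, $d\sim c\sim b$; * crossing symmetry: $W\left(\begin{smallmatrix}d&c\\a&b\end{smallmatrix}\middle|u\right)=W\left(\begin{smallmatrix}c&b\\d&a\end{smallmatrix}\middle|\lambda-u\right)$; * initial condition: $W\left(\begin{smallmatrix}d&c\\a&b\end{smallmatrix}\middle|0\right)=\delta_{ac}$ for $d\sim c\sim b$, $d\sim a\sim b$. Let $\mathcal H^n$ and $\mathcal V^n$ denote the space spanned by the paths $(a_0,\dots,a_n)$ with $a_{k-1}\sim a_k$. Fix $L\ge1$ and inhomogeneities $u_1,\dots,u_L\in\mathbb C$. The single-row operators on $\mathcal H^L$ are $$\langle\mathbf a|T^{\alpha_0\beta_0}_{\alpha_1\beta_1}(v)|\mathbf b\rangle=\delta_{a_0\alpha_0}\delta_{a_L\beta_0}\delta_{b_0\alpha_1}\delta_{b_L\beta_1}\prod_{i=1}^LW\left(\begin{smallmatrix}a_{i-1}&a_i\\b_{i-1}&b_i\end{smallmatrix}\middle|v-u_i\right),$$ and the transfer matrix is $t(v)=\sum_{\alpha,\beta}T^{\alpha\alpha}_{\beta\beta}(v)$. Let $|\Phi\rangle$, $\langle\Phi|$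 be supported on periodic paths ($a_0=a_L$), with $t(v)|\Phi\rangle=\Lambda(v)|\Phi\rangle$ and $\langle\Phi|t(v)=\Lambda(v)\langle\Phi|$ for all $v$, and $\langle\Phi|\Phi\rangle\neq0$. For $N\ge1$ and $\lambda_1,\dots,\lambda_N\in\mathbb C$ the generalized $N$-site density matrix is the operator on $\mathcal V^N$ with matrix elements $$D_N(\lambda_1,\dots,\lambda_N)^{\{\alpha\}\{\beta\}}=\frac{\langle\Phi|\,T^{\alpha_0\beta_0}_{\alpha_1\beta_1}(\lambda_1)\cdots T^{\alpha_{N-1}\beta_{N-1}}_{\alpha_N\beta_N}(\lambda_N)\,|\Phi\rangle}{\langle\Phi|\Phi\rangle\prod_{k=1}^N\Lambda(\lambda_k)},$$ and the linear operator $A_N(\lambda_1,\dots,\lambda_N)$ on $\mathrm{End}(\mathcal V^N)$ is $$\big(A_N[B]\big)^{\{\alpha\}\{\beta\}}=\frac{\delta_{\alpha_0\beta_0}\delta_{\alpha_N\beta_N}}{\prod_{i=1}^N\rho(\lambda_i-\lambda_N)\rho(\lambda_N-\lambda_i)}\sum_{\{\gamma\},\{\delta\}}\delta_{\alpha_{N-1}\gamma_N}\prod_{i=1}^{N-1}W\left(\begin{smallmatrix}\gamma_{i-1}&\gamma_i\\\alpha_{i-1}&\alpha_i\end{smallmatrix}\middle|\lambda_N-\lambda_i\right)B^{\{\gamma\}\{\delta\}}\prod_{i=1}^{N-1}W\left(\begin{smallmatrix}\delta_{i-1}&\beta_{i-1}\\\delta_i&\beta_i\end{smallmatrix}\middle|\lambda_i-\lambda_N\right)W\left(\begin{smallmatrix}\delta_{N-1}&\beta_{N-1}\\\delta_N&\beta_N\end{smallmatrix}\middle|\lambda\right).$$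 **Theorem.** Let $N\ge1$ and suppose that the expressions below are defined, i.e. $\rho(\lambda_i-\lambda_N)$, $\rho(\lambda_N-\lambda_i)$, $\Lambda(\lambda_i)$ ($1\le i\le N$) and $\Lambda(\lambda_N+\lambda)$ are nonzero. 1. If $\lambda_N\in\{u_1,\dots,u_L\}$, then $$A_N(\lambda_1,\dots,\lambda_N)[D_N(\lambda_1,\dots,\lambda_N)]=D_N(\lambda_1,\dots,\lambda_{N-1},\lambda_N+\lambda).$$ 2. Without any restriction on $\lambda_N$, this equation holds for every matrix element $(\{\alpha\},\{\beta\})$ for which $\alpha_{N-1}=\beta_{N-1}$ is a leaf of the adjacency graph, i.e. has exactly one neighbour. -/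

import Mathlib

/-- A face (interaction-round-a-face) model with heights in `S`: an undirected adjacency graph on
`S` (loops are allowed) and Boltzmann weights. `W d c a b u` is the weight, at spectral parameter
`u`, of a face whose corners carry the heights `d` (top left), `c` (top right), `a` (bottom left)
and `b` (bottom right); only faces with adjacent heights on all four edges have a weight. -/
structure FaceModel (S : Type*) where
  Adj : S → S → Prop
  adj_symm : ∀ a b, Adj a b → Adj b a
  W : S → S → S → S → ℂ → ℂ
  W_eq_zero : ∀ d c a b u, ¬ (Adj d c ∧ Adj d a ∧ Adj a b ∧ Adj c b) → W d c a b u = 0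

namespace FaceModel

/-- The local relations of an integrable face model with crossing parameter `lam` and unitarity
function `ρ`. -/
structure IsIntegrable {S : Type*} [Fintype S] [DecidableEq S] (M : FaceModel S)
    (ρ : ℂ → ℂ) (lam : ℂ) : Prop where
  yang_baxter : ∀ (a b c d e f : S) (u v : ℂ),
    ∑ g, M.W f g a b (u - v) * M.W f e g d v * M.W g d b c u =
      ∑ g, M.W f e a g u * M.W a g b c v * M.W e d g c (u - v)
  unitarity : ∀ (a b c d : S) (u : ℂ), M.Adj d a → M.Adj a b → M.Adj d c → M.Adj c b →
    ∑ e, M.W d e a b u * M.W d c e b (-u) = ρ u * ρ (-u) * (if a = c then 1 else 0)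
  crossing : ∀ (a b c d : S) (u : ℂ), M.W d c a b u = M.W c b d a (lam - u)
  initial : ∀ a b c d : S, M.Adj d c → M.Adj d a → M.Adj a b → M.Adj c b →
    M.W d c a b 0 = if a = c then 1 else 0
  rho_zero : ρ 0 ^ 2 = 1

/-- Fusion paths `(a_0, …, a_n)` on the adjacency graph. They label the standard basis of the
quantum space `𝓗^n` (horizontal lines) and of the auxiliary space `𝓥^n` (vertical lines). -/
def Path {S : Type*} (M : FaceModel S) (n : ℕ) : Type _ :=
  {a : Fin (n + 1) → S // ∀ i : Fin n, M.Adj (a i.castSucc) (a i.succ)}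

noncomputable instance {S : Type*} [Fintype S] [DecidableEq S] (M : FaceModel S) (n : ℕ) :
    Fintype (M.Path n) := by
  classical
  exact inferInstanceAs
    (Fintype {a : Fin (n + 1) → S // ∀ i : Fin n, M.Adj (a i.castSucc) (a i.succ)})

instance {S : Type*} [DecidableEq S] (M : FaceModel S) (n : ℕ) : DecidableEq (M.Path n) :=
  inferInstanceAs
    (DecidableEq {a : Fin (n + 1) → S // ∀ i : Fin n, M.Adj (a i.castSucc) (a i.succ)})

/-- The single-row operator `T^{α₀ β₀}_{α₁ β₁}(v)` on `𝓗^L`, with inhomogeneities `u_1, …, u_L`. -/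
def row {S : Type*} [DecidableEq S] (M : FaceModel S) {L : ℕ} (u : Fin L → ℂ)
    (α₀ β₀ α₁ β₁ : S) (v : ℂ) : Matrix (M.Path L) (M.Path L) ℂ :=
  Matrix.of fun a b =>
    (∏ i : Fin L, M.W (a.1 i.castSucc) (a.1 i.succ) (b.1 i.castSucc) (b.1 i.succ) (v - u i)) *
      (if a.1 0 = α₀ then 1 else 0) * (if a.1 (Fin.last L) = β₀ then 1 else 0) *
      (if b.1 0 = α₁ then 1 else 0) * (if b.1 (Fin.last L) = β₁ then 1 else 0)

/-- The transfer matrix `t(v) = ∑_{α, β} T^{α α}_{β β}(v)`. -/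
def transfer {S : Type*} [Fintype S] [DecidableEq S] (M : FaceModel S) {L : ℕ} (u : Fin L → ℂ)
    (v : ℂ) : Matrix (M.Path L) (M.Path L) ℂ :=
  ∑ α : S, ∑ β : S, M.row u α α β β v

/-- An eigenstate of the transfer matrices: a right eigenvector `|Φ⟩` and a left eigenvector `⟨Φ|`
in the periodic quantum space, for the same eigenvalue `Λ(v)`, with `⟨Φ|Φ⟩ ≠ 0`. -/
structure Eigenstate {S : Type*} [Fintype S] [DecidableEq S] (M : FaceModel S) {L : ℕ}
    (u : Fin L → ℂ) where
  ket : M.Path L → ℂ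
  bra : M.Path L → ℂ
  eigenvalue : ℂ → ℂ
  ket_periodic : ∀ a : M.Path L, a.1 0 ≠ a.1 (Fin.last L) → ket a = 0
  bra_periodic : ∀ a : M.Path L, a.1 0 ≠ a.1 (Fin.last L) → bra a = 0
  transfer_ket : ∀ v : ℂ, (M.transfer u v).mulVec ket = eigenvalue v • ket
  bra_transfer : ∀ v : ℂ, Matrix.vecMul bra (M.transfer u v) = eigenvalue v • bra
  pairing_ne_zero : bra ⬝ᵥ ket ≠ 0

/-- `N` consecutive rows `∏_{k=1}^N T^{α_{k-1} β_{k-1}}_{α_k β_k}(x_k)` (product from left to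
right), with fixed auxiliary paths `α` and `β`. -/
noncomputable def rows {S : Type*} [Fintype S] [DecidableEq S] (M : FaceModel S) {L : ℕ}
    (u : Fin L → ℂ) {N : ℕ} (x : Fin N → ℂ) (α β : M.Path N) : Matrix (M.Path L) (M.Path L) ℂ :=
  (List.ofFn fun k : Fin N =>
    M.row u (α.1 k.castSucc) (β.1 k.castSucc) (α.1 k.succ) (β.1 k.succ) (x k)).prod

/-- The generalized `N`-site density matrix `D_N(x_1, …, x_N)` on `𝓥^N`. -/
noncomputable def density {S : Type*} [Fintype S] [DecidableEq S] (M : FaceModel S) {L : ℕ}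
    (u : Fin L → ℂ) (Φ : M.Eigenstate u) {N : ℕ} (x : Fin N → ℂ) :
    Matrix (M.Path N) (M.Path N) ℂ :=
  Matrix.of fun α β =>
    (Φ.bra ⬝ᵥ (M.rows u x α β).mulVec Φ.ket) /
      ((Φ.bra ⬝ᵥ Φ.ket) * ∏ k : Fin N, Φ.eigenvalue (x k))

/-- The linear operator `A_N(x_1, …, x_N)` on `End(𝓥^N)`, for `N = n + 1`. The last weight, at the
crossing parameter `lam`, is `P_-`. -/
noncomputable def opA {S : Type*} [Fintype S] [DecidableEq S] (M : FaceModel S)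
    (ρ : ℂ → ℂ) (lam : ℂ) {n : ℕ} (x : Fin (n + 1) → ℂ) :
    Matrix (M.Path (n + 1)) (M.Path (n + 1)) ℂ →ₗ[ℂ]
      Matrix (M.Path (n + 1)) (M.Path (n + 1)) ℂ where
  toFun B := Matrix.of fun α β =>
    ((if α.1 0 = β.1 0 then 1 else 0) *
        (if α.1 (Fin.last (n + 1)) = β.1 (Fin.last (n + 1)) then 1 else 0)) /
      (∏ i : Fin (n + 1), ρ (x i - x (Fin.last n)) * ρ (x (Fin.last n) - x i)) *
    ∑ γ : M.Path (n + 1), ∑ δ : M.Path (n + 1),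
      (if α.1 (Fin.last n).castSucc = γ.1 (Fin.last (n + 1)) then 1 else 0) *
      (∏ i : Fin n, M.W (γ.1 i.castSucc.castSucc) (γ.1 i.castSucc.succ)
        (α.1 i.castSucc.castSucc) (α.1 i.castSucc.succ) (x (Fin.last n) - x i.castSucc)) *
      B γ δ *
      (∏ i : Fin n, M.W (δ.1 i.castSucc.castSucc) (β.1 i.castSucc.castSucc)
        (δ.1 i.castSucc.succ) (β.1 i.castSucc.succ) (x i.castSucc - x (Fin.last n))) *
      M.W (δ.1 (Fin.last n).castSucc) (β.1 (Fin.last n).castSucc)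
        (δ.1 (Fin.last (n + 1))) (β.1 (Fin.last (n + 1))) lam
  map_add' B C := by
    ext α β
    simp only [Matrix.of_apply, Matrix.add_apply, mul_add, add_mul, Finset.sum_add_distrib]
  map_smul' c B := by
    ext α β
    simp only [Matrix.of_apply, Matrix.smul_apply, smul_eq_mul, RingHom.id_apply,
      Finset.mul_sum]
    refine Finset.sum_congr rfl fun γ _ => Finset.sum_congr rfl fun δ _ => ?_
    ring

end FaceModel

namespace FaceModel

/-! Write `z` for the last spectral parameter. The argument creates a row at `z + lam` below the
others and moves the row at `z` to the top.

Bottom: applied to `Φ.ket`, a row at `z` times `Φ.eigenvalue (z + lam)` equals that row followed by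
a transfer matrix at `z + lam`, a sum over the new boundary height. Under the hypothesis of either
case, this together with the weight at `lam` becomes a single pair of rows at `z` and `z + lam` with
the prescribed boundary heights. At an inhomogeneity this holds because the initial condition and
crossing reconnect the lines in one column, and unitarity removes all columns to its right
(`rowWeight_cut`). At a leaf the sum over the new height has only one term.

Middle: the faces of `opA` on the two sides carry the row at `z` upwards through each remaining row:
Yang–Baxter moves the left face to the right (`row_exchange`), where unitarity cancels it against
the right face (`sum_W_smul_row_mul_row`). This produces exactly the `ρ` factors in the
normalization.

Top: `Φ.bra` is periodic, so the row at `z` arrives as a transfer matrix and gives `Φ.eigenvalue z`.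
The two eigenvalues account for the change of normalization from `z` to `z + lam`. -/

/-! ### Sums over height sequences and weights of a row. -/

theorem sum_snoc {S : Type*} [Fintype S] {R : Type*} [AddCommMonoid R] {k : ℕ} (f : (Fin (k + 1) → S) → R) :
    ∑ m, f m = ∑ t : S, ∑ m : Fin k → S, f (Fin.snoc (α := fun _ => S) m t) := by
  rw [← (Fin.snocEquiv fun _ : Fin (k + 1) => S).sum_comp, Fintype.sum_prod_type]
  rfl

theorem sum_cons {S : Type*} [Fintype S] {R : Type*} [AddCommMonoid R] {k : ℕ} (f : (Fin (k + 1) → S) → R) :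
    ∑ m, f m = ∑ t : S, ∑ m : Fin k → S, f (Fin.cons (α := fun _ => S) t m) := by
  rw [← (Fin.consEquiv fun _ : Fin (k + 1) => S).sum_comp, Fintype.sum_prod_type]
  rfl

/-- Passing from paths to arbitrary height sequences allows single heights to be split off at either
end without carrying adjacency proofs. -/
theorem sum_path {S : Type*} [Fintype S] [DecidableEq S] (M : FaceModel S) {R : Type*} [AddCommMonoid R] {k : ℕ}
    (f : (Fin (k + 1) → S) → R)
    (hf : ∀ m, (¬ ∀ i : Fin k, M.Adj (m i.castSucc) (m i.succ)) → f m = 0) :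
    ∑ m : M.Path k, f m.1 = ∑ m, f m := by
  refine Fintype.sum_of_injective (fun m : M.Path k => m.1) Subtype.val_injective _ _
    (fun m hm => hf m ?_) fun _ => rfl
  exact fun h => hm ⟨⟨m, h⟩, rfl⟩

/-- The product of the weights along a row with heights `a` above and `b` below. -/
def rowWeight {S : Type*} (M : FaceModel S) {L : ℕ} (u : Fin L → ℂ) (v : ℂ) (a b : Fin (L + 1) → S) : ℂ :=
  ∏ i : Fin L, M.W (a i.castSucc) (a i.succ) (b i.castSucc) (b i.succ) (v - u i)

theorem rowWeight_succ {S : Type*} (M : FaceModel S) {L : ℕ} (u : Fin (L + 1) → ℂ) (v : ℂ)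
    (a b : Fin (L + 2) → S) :
    M.rowWeight u v a b =
      M.rowWeight (Fin.init u) v (Fin.init (α := fun _ => S) a) (Fin.init (α := fun _ => S) b) *
        M.W (a (Fin.last L).castSucc) (a (Fin.last (L + 1))) (b (Fin.last L).castSucc)
          (b (Fin.last (L + 1))) (v - u (Fin.last L)) := by
  rw [rowWeight, Fin.prod_univ_castSucc]
  rfl

theorem adj_of_rowWeight_ne_zero {S : Type*} {M : FaceModel S} {L : ℕ} {u : Fin L → ℂ} {v : ℂ}
    {a b : Fin (L + 1) → S} (h : M.rowWeight u v a b ≠ 0) (i : Fin L) :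
    M.Adj (a i.castSucc) (a i.succ) ∧ M.Adj (a i.castSucc) (b i.castSucc) ∧
      M.Adj (b i.castSucc) (b i.succ) ∧ M.Adj (a i.succ) (b i.succ) := by
  by_contra hi
  exact h (Finset.prod_eq_zero (Finset.mem_univ i) (M.W_eq_zero _ _ _ _ _ hi))

/-! ### Exchange and cutting of two adjacent rows. -/

/-- The auxiliary face at `x - y` is pushed through the columns one at a time, each by one
Yang–Baxter equation; the inhomogeneity of the column drops out of the difference. -/
theorem IsIntegrable.rowWeight_exchange {S : Type*} [Fintype S] [DecidableEq S]
    {M : FaceModel S} {ρ : ℂ → ℂ} {lam : ℂ}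
    (hM : M.IsIntegrable ρ lam) (x y : ℂ) (A d : S) {L : ℕ} (u : Fin L → ℂ)
    (a c : Fin (L + 1) → S) :
    ∑ m : Fin (L + 1) → S, (if m (Fin.last L) = d then 1 else 0) *
        (M.W (a 0) (m 0) A (c 0) (x - y) * (M.rowWeight u y a m * M.rowWeight u x m c)) =
      ∑ m : Fin (L + 1) → S, (if m 0 = A then 1 else 0) *
        (M.W (a (Fin.last L)) d (m (Fin.last L)) (c (Fin.last L)) (x - y) *
          (M.rowWeight u x a m * M.rowWeight u y m c)) := by
  induction L generalizing d with
  | zero =>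
    rw [← (Equiv.funUnique (Fin 1) S).symm.sum_comp, ← (Equiv.funUnique (Fin 1) S).symm.sum_comp]
    simp [rowWeight]
  | succ L ih =>
    have key := fun g => ih g (Fin.init u) (Fin.init (α := fun _ => S) a)
      (Fin.init (α := fun _ => S) c)
    have e1 : ∀ (b : Fin (L + 2) → S), Fin.init (α := fun _ => S) b 0 = b 0 := fun _ => rfl
    have e2 : ∀ (b : Fin (L + 2) → S), Fin.init (α := fun _ => S) b (Fin.last L) =
      b (Fin.last L).castSucc := fun _ => rfl
    have e3 : ∀ (m : Fin (L + 1) → S) (t : S),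
      (Fin.snoc (α := fun _ => S) m t : Fin (L + 2) → S) 0 = m 0 := fun m t => by
      rw [← Fin.castSucc_zero, Fin.snoc_castSucc]
    simp only [e1, e2] at key
    set aL := a (Fin.last L).castSucc
    set cL := c (Fin.last L).castSucc
    set aE := a (Fin.last (L + 1))
    set cE := c (Fin.last (L + 1))
    rw [sum_snoc, sum_snoc]
    simp only [rowWeight_succ, Fin.init_snoc, Fin.snoc_last, Fin.snoc_castSucc, e3]
    -- The right end of the shortened middle row becomes a separate variable `g`, so that the
    -- induction hypothesis applies with `d := g`.
    have l1 : ∀ t : S, ∑ m : Fin (L + 1) → S, (if t = d then (1 : ℂ) else 0) *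
        (M.W (a 0) (m 0) A (c 0) (x - y) *
          (M.rowWeight (Fin.init u) y (Fin.init (α := fun _ => S) a) m *
              M.W aL aE (m (Fin.last L)) t (y - u (Fin.last L)) *
            (M.rowWeight (Fin.init u) x m (Fin.init (α := fun _ => S) c) *
              M.W (m (Fin.last L)) t cL cE (x - u (Fin.last L))))) =
        (if t = d then (1 : ℂ) else 0) * ∑ g, (M.W aL aE g t (y - u (Fin.last L)) *
          M.W g t cL cE (x - u (Fin.last L))) *
          ∑ m : Fin (L + 1) → S, (if m 0 = A then 1 else 0) *
        (M.W aL g (m (Fin.last L)) cL (x - y) *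
          (M.rowWeight (Fin.init u) x (Fin.init (α := fun _ => S) a) m *
            M.rowWeight (Fin.init u) y m (Fin.init (α := fun _ => S) c))) := by
      intro t
      rw [← Finset.mul_sum]
      congr 1
      simp only [← key, Finset.mul_sum]
      rw [Finset.sum_comm]
      refine Finset.sum_congr rfl fun m _ => ?_
      rw [Finset.sum_eq_single (m (Fin.last L))]
      · simp only [if_true]; ring
      · intro g _ hg; simp [Ne.symm hg]
      · simp
    rw [Finset.sum_congr rfl fun t _ => l1 t, Finset.sum_eq_single d]
    rotate_left
    · intro t _ ht; simp [ht]
    · simp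
    simp only [if_true, one_mul, Finset.mul_sum]
    rw [Finset.sum_comm]
    conv_rhs => rw [Finset.sum_comm]
    refine Finset.sum_congr rfl fun m _ => ?_
    have yb := hM.yang_baxter (m (Fin.last L)) cL cE d aE aL (x - u (Fin.last L))
      (y - u (Fin.last L))
    rw [sub_sub_sub_cancel_right] at yb
    calc _ = ((if m 0 = A then 1 else 0) *
        (M.rowWeight (Fin.init u) x (Fin.init (α := fun _ => S) a) m *
          M.rowWeight (Fin.init u) y m (Fin.init (α := fun _ => S) c))) *
        ∑ g, M.W aL g (m (Fin.last L)) cL (x - y) * M.W aL aE g d (y - u (Fin.last L)) *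
          M.W g d cL cE (x - u (Fin.last L)) := by
          rw [Finset.mul_sum]
          exact Finset.sum_congr rfl fun g _ => by ring
      _ = _ := by
          rw [yb, Finset.mul_sum]
          exact Finset.sum_congr rfl fun g _ => by ring

-- The point is that `K` does not depend on `q`. In column `i` the weights at `0` and `lam` are
-- Kronecker deltas, which decouple the middle heights on its two sides; every later column is
-- removed by unitarity.
open scoped Classical in
theorem IsIntegrable.rowWeight_cut {S : Type*} [Fintype S] [DecidableEq S]
    {M : FaceModel S} {ρ : ℂ → ℂ} {lam : ℂ}
    (hM : M.IsIntegrable ρ lam) (p : S) {L : ℕ} (u : Fin L → ℂ) (i : Fin L)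
    (a c : Fin (L + 1) → S) :
    ∃ K : ℂ, ∀ q : S,
      ∑ m : Fin (L + 1) → S, (if m 0 = p then 1 else 0) * (if m (Fin.last L) = q then 1 else 0) *
        (M.rowWeight u (u i) a m * M.rowWeight u (u i + lam) m c) =
      if a (Fin.last L) = c (Fin.last L) ∧ M.Adj q (a (Fin.last L)) then K else 0 := by
  induction L with
  | zero => exact i.elim0
  | succ L ih =>
    have e3 : ∀ (m : Fin (L + 1) → S) (t : S),
      (Fin.snoc (α := fun _ => S) m t : Fin (L + 2) → S) 0 = m 0 := fun m t => by
      rw [← Fin.castSucc_zero, Fin.snoc_castSucc]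
    have red : ∀ q : S, (∑ m : Fin (L + 2) → S, (if m 0 = p then (1 : ℂ) else 0) *
        (if m (Fin.last (L + 1)) = q then 1 else 0) *
        (M.rowWeight u (u i) a m * M.rowWeight u (u i + lam) m c)) =
        ∑ m : Fin (L + 1) → S, (if m 0 = p then 1 else 0) *
          (M.rowWeight (Fin.init u) (u i) (Fin.init (α := fun _ => S) a) m *
            M.rowWeight (Fin.init u) (u i + lam) m (Fin.init (α := fun _ => S) c)) *
          (M.W (a (Fin.last L).castSucc) (a (Fin.last (L + 1))) (m (Fin.last L)) q
            (u i - u (Fin.last L)) *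
          M.W (m (Fin.last L)) q (c (Fin.last L).castSucc) (c (Fin.last (L + 1)))
            (u i + lam - u (Fin.last L))) := by
      intro q
      rw [sum_snoc, Finset.sum_eq_single q]
      · simp only [rowWeight_succ, Fin.init_snoc, Fin.snoc_last, Fin.snoc_castSucc, e3, if_true]
        exact Finset.sum_congr rfl fun m _ => by ring
      · intro t _ ht; simp [ht]
      · simp
    simp only [red]
    set aL := a (Fin.last L).castSucc with haL
    set cL := c (Fin.last L).castSucc with hcL
    set aE := a (Fin.last (L + 1))
    set cE := c (Fin.last (L + 1))
    induction i using Fin.lastCases with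
    | last =>
      refine ⟨∑ m : Fin (L + 1) → S, (if m 0 = p then 1 else 0) *
          (M.rowWeight (Fin.init u) (u (Fin.last L)) (Fin.init (α := fun _ => S) a) m *
            M.rowWeight (Fin.init u) (u (Fin.last L) + lam) m (Fin.init (α := fun _ => S) c)) *
          (if m (Fin.last L) = aE ∧ M.Adj aL aE ∧ M.Adj cL aE then 1 else 0), fun q => ?_⟩
      -- The upper face forces `g = aE` and the lower one, after crossing, `g = cE`; `q` survives
      -- only in the support condition.
      have hW : ∀ g : S, M.W aL aE g q (u (Fin.last L) - u (Fin.last L)) *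
          M.W g q cL cE (u (Fin.last L) + lam - u (Fin.last L)) =
          if aE = cE ∧ M.Adj q aE then
            (if g = aE ∧ M.Adj aL aE ∧ M.Adj cL aE then 1 else 0) else 0 := by
        intro g
        rw [sub_self, add_sub_cancel_left, hM.crossing cL cE q g lam, sub_self]
        by_cases h1 : M.Adj aL aE ∧ M.Adj aL g ∧ M.Adj g q ∧ M.Adj aE q
        · by_cases h2 : M.Adj q cE ∧ M.Adj q g ∧ M.Adj g cL ∧ M.Adj cE cL
          · rw [hM.initial _ _ _ _ h1.1 h1.2.1 h1.2.2.1 h1.2.2.2,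
              hM.initial _ _ _ _ h2.1 h2.2.1 h2.2.2.1 h2.2.2.2]
            have := M.adj_symm
            grind
          · rw [M.W_eq_zero _ _ _ _ _ h2]
            have := M.adj_symm
            grind
        · rw [M.W_eq_zero _ _ _ _ _ h1]
          have := M.adj_symm
          grind
      simp only [hW]
      split_ifs <;> simp
    | cast i =>
      obtain ⟨K, hK⟩ := ih (Fin.init u) i (Fin.init (α := fun _ => S) a)
        (Fin.init (α := fun _ => S) c)
      have e2 : ∀ (b : Fin (L + 2) → S), Fin.init (α := fun _ => S) b (Fin.last L) =
        b (Fin.last L).castSucc := fun _ => rfl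
      have e4 : Fin.init (α := fun _ => ℂ) u i = u i.castSucc := rfl
      simp only [e2, ← haL, ← hcL, e4] at hK
      set v := u i.castSucc - u (Fin.last L) with hv
      -- A column to the right of the cut contributes its unitarity factor.
      refine ⟨if aL = cL ∧ M.Adj aL aE then K * (ρ v * ρ (-v)) else 0, fun q => ?_⟩
      have hv' : u i.castSucc + lam - u (Fin.last L) = lam + v := by rw [hv]; ring
      rw [hv']
      -- Three quarter turns by crossing bring the lower face into the position required by
      -- unitarity.
      have hcr : ∀ g, M.W g q cL cE (lam + v) = M.W cL g cE q (-v) := fun g => by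
        rw [hM.crossing, hM.crossing, hM.crossing]; congr 1; ring
      have step : (∑ m : Fin (L + 1) → S, (if m 0 = p then (1 : ℂ) else 0) *
          (M.rowWeight (Fin.init u) (u i.castSucc) (Fin.init (α := fun _ => S) a) m *
            M.rowWeight (Fin.init u) (u i.castSucc + lam) m (Fin.init (α := fun _ => S) c)) *
          (M.W aL aE (m (Fin.last L)) q v * M.W (m (Fin.last L)) q cL cE (lam + v))) =
          ∑ g, (if aL = cL ∧ M.Adj g aL then K else 0) *
            (M.W aL aE g q v * M.W cL g cE q (-v)) := by
        simp only [← hK, Finset.sum_mul]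
        rw [Finset.sum_comm]
        refine Finset.sum_congr rfl fun m _ => ?_
        rw [Finset.sum_eq_single (m (Fin.last L))]
        · simp only [if_true, hcr]; ring
        · intro g _ hg; simp [Ne.symm hg]
        · simp
      rw [step]
      by_cases hac : aL = cL
      · rw [← hac]
        -- The adjacency condition from the induction hypothesis is already enforced by the weight,
        -- so `K` leaves the sum.
        have hterm : ∀ g, (if aL = aL ∧ M.Adj g aL then K else 0) *
            (M.W aL aE g q v * M.W aL g cE q (-v)) =
            K * (M.W aL g cE q (-v) * M.W aL aE g q (- -v)) := by
          intro g
          rw [neg_neg]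
          split_ifs with h
          · ring
          · rw [M.W_eq_zero aL aE g q v fun h' => h ⟨rfl, M.adj_symm _ _ h'.2.1⟩]; ring
        rw [Finset.sum_congr rfl fun g _ => hterm g, ← Finset.mul_sum]
        by_cases hadj : M.Adj aL cE ∧ M.Adj cE q ∧ M.Adj aL aE ∧ M.Adj aE q
        · rw [hM.unitarity _ _ _ _ _ hadj.1 hadj.2.1 hadj.2.2.1 hadj.2.2.2, neg_neg]
          have := M.adj_symm _ _ hadj.2.2.2
          by_cases h : aE = cE
          · rw [if_pos h.symm, if_pos ⟨h, this⟩, if_pos ⟨rfl, hadj.2.2.1⟩]; ring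
          · rw [if_neg (Ne.symm h), if_neg fun h' => h h'.1]; ring
        · have : (∑ g, M.W aL g cE q (-v) * M.W aL aE g q (- -v)) = 0 := by
            refine Finset.sum_eq_zero fun g _ => ?_
            by_cases h1 : M.Adj aL cE ∧ M.Adj cE q
            · rw [M.W_eq_zero aL aE g q _ fun h' => hadj ⟨h1.1, h1.2, h'.1, h'.2.2.2⟩, mul_zero]
            · rw [M.W_eq_zero aL g cE q _ fun h' => h1 ⟨h'.2.1, h'.2.2.1⟩, zero_mul]
          rw [this, mul_zero]
          have := M.adj_symm
          grind
      · simp [hac]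

/-! ### Products of single-row operators. -/

theorem row_apply {S : Type*} [DecidableEq S] (M : FaceModel S) {L : ℕ} (u : Fin L → ℂ)
    (p q r s : S) (v : ℂ) (a b : M.Path L) :
    M.row u p q r s v a b =
      if a.1 0 = p ∧ a.1 (Fin.last L) = q ∧ b.1 0 = r ∧ b.1 (Fin.last L) = s then
        M.rowWeight u v a.1 b.1 else 0 := by
  simp only [row, Matrix.of_apply, rowWeight]
  split_ifs <;> simp_all

/-- The first and last columns supply the two adjacencies. With `L = 0` the product of weights is
empty and imposes none. -/
theorem row_eq_zero_of_not_adj {S : Type*} [DecidableEq S] (M : FaceModel S) {L : ℕ}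
    (hL : 0 < L) (u : Fin L → ℂ) {p q r s : S} (v : ℂ) (h : ¬ (M.Adj p r ∧ M.Adj q s)) :
    M.row u p q r s v = 0 := by
  obtain ⟨L, rfl⟩ := Nat.exists_eq_succ_of_ne_zero hL.ne'
  ext a b
  rw [row_apply, Matrix.zero_apply]
  split_ifs with hab
  · obtain ⟨rfl, rfl, rfl, rfl⟩ := hab
    by_contra hne
    exact h ⟨(adj_of_rowWeight_ne_zero hne 0).2.1,
      (adj_of_rowWeight_ne_zero hne (Fin.last L)).2.2.2⟩
  · rfl

theorem row_mul_row_apply {S : Type*} [Fintype S] [DecidableEq S] (M : FaceModel S) {L : ℕ}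
    (u : Fin L → ℂ) (p q r s p' q' : S) (v w : ℂ) (a c : M.Path L) :
    (M.row u p q r s v * M.row u r s p' q' w) a c =
      if a.1 0 = p ∧ a.1 (Fin.last L) = q ∧ c.1 0 = p' ∧ c.1 (Fin.last L) = q' then
        ∑ m : Fin (L + 1) → S, (if m 0 = r then 1 else 0) * (if m (Fin.last L) = s then 1 else 0) *
          (M.rowWeight u v a.1 m * M.rowWeight u w m c.1) else 0 := by
  rw [Matrix.mul_apply]
  simp only [row_apply]
  split_ifs with h
  · rw [← sum_path M]
    · refine Finset.sum_congr rfl fun m _ => ?_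
      split_ifs <;> simp_all
    · intro m hm
      have : M.rowWeight u v a.1 m = 0 := by
        by_contra hne
        exact hm fun i => (adj_of_rowWeight_ne_zero hne i).2.2.1
      rw [this]; ring
  · refine Finset.sum_eq_zero fun m _ => ?_
    split_ifs with h1 h2
    · exact absurd ⟨h1.1, h1.2.1, h2.2.2⟩ h
    all_goals simp

theorem row_mul_row_of_ne {S : Type*} [Fintype S] [DecidableEq S] (M : FaceModel S) {L : ℕ}
    (u : Fin L → ℂ) {p q r s r' s' p' q' : S} (v w : ℂ) (h : ¬ (r = r' ∧ s = s')) :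
    M.row u p q r s v * M.row u r' s' p' q' w = 0 := by
  ext a c
  rw [Matrix.mul_apply, Matrix.zero_apply]
  refine Finset.sum_eq_zero fun m _ => ?_
  simp only [row_apply]
  split_ifs with h1 h2
  · exact absurd ⟨h1.2.2.1.symm.trans h2.1, h1.2.2.2.symm.trans h2.2.1⟩ h
  all_goals simp

/-- The Yang–Baxter equation for whole rows. -/
theorem IsIntegrable.row_exchange {S : Type*} [Fintype S] [DecidableEq S] {M : FaceModel S}
    {ρ : ℂ → ℂ} {lam : ℂ} (hM : M.IsIntegrable ρ lam) {L : ℕ} (u : Fin L → ℂ)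
    (A b c d e f : S) (x y : ℂ) :
    ∑ g, M.W f g A b (x - y) • (M.row u f e g d y * M.row u g d b c x) =
      ∑ g, M.W e d g c (x - y) • (M.row u f e A g x * M.row u A g b c y) := by
  ext a k
  simp only [Matrix.sum_apply, Matrix.smul_apply, row_mul_row_apply, smul_eq_mul]
  split_ifs with h
  · obtain ⟨rfl, rfl, rfl, rfl⟩ := h
    have key := hM.rowWeight_exchange x y A d u a.1 k.1
    simp only [Finset.mul_sum]
    rw [Finset.sum_comm]
    conv_rhs => rw [Finset.sum_comm]
    refine Eq.trans (Finset.sum_congr rfl fun m _ => ?_)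
      (key.trans (Finset.sum_congr rfl fun m _ => ?_))
    · rw [Finset.sum_eq_single (m 0)]
      · rw [if_pos rfl]; ring
      · intro g _ hg; rw [if_neg (Ne.symm hg)]; ring
      · simp
    · rw [Finset.sum_eq_single (m (Fin.last L))]
      · rw [if_pos rfl (c := m (Fin.last L) = m (Fin.last L))]; ring
      · intro g _ hg; rw [if_neg (Ne.symm hg)]; ring
      · simp
  · simp

/-- At an inhomogeneity the horizontal line is cut by the corresponding vertical line, so that two
rows at distance `lam` depend on the height between them on the right only through adjacency. -/
theorem IsIntegrable.row_mul_row_cut {S : Type*} [Fintype S] [DecidableEq S] {M : FaceModel S}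
    {ρ : ℂ → ℂ} {lam : ℂ} (hM : M.IsIntegrable ρ lam) {L : ℕ} (u : Fin L → ℂ) (i : Fin L)
    {d q q' : S} (g p r : S) (hq : M.Adj q d) (hq' : M.Adj q' d) :
    M.row u g d p q (u i) * M.row u p q r d (u i + lam) =
      M.row u g d p q' (u i) * M.row u p q' r d (u i + lam) := by
  ext a c
  obtain ⟨K, hK⟩ := hM.rowWeight_cut p u i a.1 c.1
  simp only [row_mul_row_apply, hK]
  split_ifs with h1 h2 h3 <;> try rfl
  · exact absurd ⟨h2.1, by rwa [h1.2.1]⟩ h3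
  · exact absurd ⟨h1.2.1.trans h1.2.2.2.symm, by rwa [h1.2.1]⟩ h2

theorem IsIntegrable.row_mul_row_cut_of_ne {S : Type*} [Fintype S] [DecidableEq S]
    {M : FaceModel S} {ρ : ℂ → ℂ} {lam : ℂ} (hM : M.IsIntegrable ρ lam) {L : ℕ} (u : Fin L → ℂ)
    (i : Fin L) {d s : S} (g p q r : S) (h : d ≠ s) :
    M.row u g d p q (u i) * M.row u p q r s (u i + lam) = 0 := by
  ext a c
  obtain ⟨K, hK⟩ := hM.rowWeight_cut p u i a.1 c.1
  rw [row_mul_row_apply, hK, Matrix.zero_apply]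
  split_ifs with h1 h2 <;> try rfl
  exact absurd (h1.2.1.symm.trans (h2.1.trans h1.2.2.2)) h

theorem row_mul_transfer {S : Type*} [Fintype S] [DecidableEq S] (M : FaceModel S) {L : ℕ}
    (u : Fin L → ℂ) (g d p : S) (v w : ℂ) :
    M.row u g d p p v * M.transfer u w = ∑ s, M.row u g d p p v * M.row u p p s s w := by
  rw [transfer, Matrix.mul_sum, Finset.sum_eq_single p, Matrix.mul_sum]
  · intro p' _ hp'
    rw [Matrix.mul_sum]
    exact Finset.sum_eq_zero fun s _ => row_mul_row_of_ne M u v w fun h => hp' h.1.symm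
  · simp

theorem transfer_mul_row {S : Type*} [Fintype S] [DecidableEq S] (M : FaceModel S) {L : ℕ}
    (u : Fin L → ℂ) (p r s : S) (v w : ℂ) :
    M.transfer u v * M.row u p p r s w = ∑ g, M.row u g g p p v * M.row u p p r s w := by
  rw [transfer, Matrix.sum_mul]
  refine Finset.sum_congr rfl fun g _ => ?_
  rw [Matrix.sum_mul, Finset.sum_eq_single p]
  · exact fun p' _ hp' => row_mul_row_of_ne M u v w fun h => hp' h.1
  · simp

/-! ### Periodicity and the eigenvalue equations. -/

namespace Eigenstate

open Matrix

variable {S : Type*} [Fintype S] [DecidableEq S] {M : FaceModel S} {L : ℕ} {u : Fin L → ℂ}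
  (Φ : M.Eigenstate u)

theorem row_mulVec_ket_of_ne {r s : S} (p q : S) (v : ℂ) (h : r ≠ s) :
    M.row u p q r s v *ᵥ Φ.ket = 0 := by
  ext a
  refine Finset.sum_eq_zero fun b _ => ?_
  change M.row u p q r s v a b * Φ.ket b = 0
  rw [row_apply]
  split_ifs with hab
  · rw [Φ.ket_periodic b (by rw [hab.2.2.1, hab.2.2.2]; exact h), mul_zero]
  · rw [zero_mul]

theorem bra_vecMul_row_of_ne {p q : S} (r s : S) (v : ℂ) (h : p ≠ q) :
    Φ.bra ᵥ* M.row u p q r s v = 0 := by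
  ext b
  refine Finset.sum_eq_zero fun a _ => ?_
  change Φ.bra a * M.row u p q r s v a b = 0
  rw [row_apply]
  split_ifs with hab
  · rw [Φ.bra_periodic a (by rw [hab.1, hab.2.1]; exact h), zero_mul]
  · rw [mul_zero]

theorem eigenvalue_smul_row_mulVec_ket (g d p : S) (v w : ℂ) :
    Φ.eigenvalue w • M.row u g d p p v *ᵥ Φ.ket =
      ∑ s, (M.row u g d p p v * M.row u p p s s w) *ᵥ Φ.ket := by
  rw [← Matrix.sum_mulVec, ← row_mul_transfer, ← Matrix.mulVec_mulVec, Φ.transfer_ket,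
    Matrix.mulVec_smul]

theorem sum_bra_row_mul_row (p r s : S) (v w : ℂ) (φ : M.Path L → ℂ) :
    ∑ g, Φ.bra ⬝ᵥ (M.row u g g p p v * M.row u p p r s w) *ᵥ φ =
      Φ.eigenvalue v * (Φ.bra ⬝ᵥ M.row u p p r s w *ᵥ φ) := by
  rw [← dotProduct_sum, ← Matrix.sum_mulVec, ← transfer_mul_row, ← Matrix.mulVec_mulVec,
    Matrix.dotProduct_mulVec, Φ.bra_transfer, smul_dotProduct, smul_eq_mul]

end Eigenstate

/-! ### Creating a row at `z + lam` next to the right eigenvector. -/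

theorem IsIntegrable.W_lam {S : Type*} [Fintype S] [DecidableEq S] {M : FaceModel S} {ρ : ℂ → ℂ}
    {lam : ℂ} (hM : M.IsIntegrable ρ lam) {d p q r : S} (hp : M.Adj p r) (hq : M.Adj q r)
    (hdp : M.Adj d p) (hdq : M.Adj d q) : M.W d q p r lam = if d = r then 1 else 0 := by
  rw [hM.crossing, sub_self, hM.initial _ _ _ _ hq (M.adj_symm _ _ hdq) hdp (M.adj_symm _ _ hp)]

theorem IsIntegrable.W_lam_self {S : Type*} [Fintype S] [DecidableEq S] {M : FaceModel S}
    {ρ : ℂ → ℂ} {lam : ℂ} (hM : M.IsIntegrable ρ lam) {p q r : S} (hp : M.Adj p r)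
    (hq : M.Adj q r) : M.W r q p r lam = 1 := by
  rw [hM.W_lam hp hq (M.adj_symm _ _ hp) (M.adj_symm _ _ hq), if_pos rfl]

theorem IsIntegrable.W_lam_of_ne {S : Type*} [Fintype S] [DecidableEq S] {M : FaceModel S}
    {ρ : ℂ → ℂ} {lam : ℂ} (hM : M.IsIntegrable ρ lam) {d p q r : S} (h : d ≠ r) :
    M.W d q p r lam = 0 := by
  by_cases hadj : M.Adj d q ∧ M.Adj d p ∧ M.Adj p r ∧ M.Adj q r
  · rw [hM.W_lam hadj.2.2.1 hadj.2.2.2 hadj.2.1 hadj.1, if_neg h]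
  · exact M.W_eq_zero _ _ _ _ _ hadj

-- The transfer matrix at `u i + lam` produces a sum over `s`, of which the cut keeps only `s = d`.
-- The cut also makes the right middle height irrelevant among neighbours of `d`, so `p` may be
-- replaced by `q`.
open Matrix in
theorem IsIntegrable.row_mul_row_mulVec_ket_of_inhomogeneity {S : Type*} [Fintype S]
    [DecidableEq S] {M : FaceModel S} {ρ : ℂ → ℂ} {lam : ℂ} (hM : M.IsIntegrable ρ lam) {L : ℕ}
    {u : Fin L → ℂ} (Φ : M.Eigenstate u) (i : Fin L) {p q r : S} (hp : M.Adj p r)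
    (hq : M.Adj q r) (g d : S) :
    (Φ.eigenvalue (u i + lam) * M.W d q p r lam) • M.row u g d p p (u i) *ᵥ Φ.ket =
      (M.row u g d p q (u i) * M.row u p q r r (u i + lam)) *ᵥ Φ.ket := by
  by_cases hd : d = r
  · subst hd
    rw [hM.W_lam_self hp hq, mul_one, Φ.eigenvalue_smul_row_mulVec_ket,
      Finset.sum_eq_single d, hM.row_mul_row_cut u i g p d hq hp]
    · intro s _ hs
      rw [hM.row_mul_row_cut_of_ne u i g p p s (Ne.symm hs), zero_mulVec]
    · simp
  · rw [hM.W_lam_of_ne hd, mul_zero, zero_smul, hM.row_mul_row_cut_of_ne u i g p q r hd,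
      zero_mulVec]

-- No cut is needed: adjacency alone reduces the sum over `s` to `s = r`, and the middle heights
-- already agree.
open Matrix in
theorem IsIntegrable.row_mul_row_mulVec_ket_of_leaf {S : Type*} [Fintype S]
    [DecidableEq S] {M : FaceModel S} {ρ : ℂ → ℂ} {lam : ℂ} (hM : M.IsIntegrable ρ lam) {L : ℕ}
    (hL : 0 < L) {u : Fin L → ℂ} (Φ : M.Eigenstate u) (z : ℂ) {p r : S} (hp : M.Adj p r)
    (hleaf : ∀ s, M.Adj p s → s = r) (g d : S) :
    (Φ.eigenvalue (z + lam) * M.W d p p r lam) • M.row u g d p p z *ᵥ Φ.ket =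
      (M.row u g d p p z * M.row u p p r r (z + lam)) *ᵥ Φ.ket := by
  by_cases hd : d = r
  · subst hd
    rw [hM.W_lam_self hp hp, mul_one, Φ.eigenvalue_smul_row_mulVec_ket, Finset.sum_eq_single d]
    · intro s _ hs
      rw [row_eq_zero_of_not_adj M hL u (z + lam) fun h => hs (hleaf s h.1), mul_zero, zero_mulVec]
    · simp
  · rw [row_eq_zero_of_not_adj M hL u z fun h => hd (hleaf d (M.adj_symm _ _ h.2)),
      zero_mul, zero_mulVec, smul_zero]

/-! ### Moving the row at `z` from the bottom to the top. -/

/-- `M.rows` for arbitrary sequences of boundary heights. -/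
noncomputable def rowsOf {S : Type*} [Fintype S] [DecidableEq S] (M : FaceModel S) {L : ℕ}
    (u : Fin L → ℂ) {N : ℕ} (x : Fin N → ℂ) (α β : Fin (N + 1) → S) :
    Matrix (M.Path L) (M.Path L) ℂ :=
  (List.ofFn fun k : Fin N =>
    M.row u (α k.castSucc) (β k.castSucc) (α k.succ) (β k.succ) (x k)).prod

theorem rowsOf_succ {S : Type*} [Fintype S] [DecidableEq S] (M : FaceModel S) {L : ℕ}
    (u : Fin L → ℂ) {N : ℕ} (x : Fin (N + 1) → ℂ) (α β : Fin (N + 2) → S) :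
    M.rowsOf u x α β = M.row u (α 0) (β 0) (α 1) (β 1) (x 0) *
      M.rowsOf u (Fin.tail x) (Fin.tail (α := fun _ => S) α) (Fin.tail (α := fun _ => S) β) := by
  rw [rowsOf, List.ofFn_succ, List.prod_cons]
  rfl

theorem rowsOf_eq_zero_of_not_path {S : Type*} [Fintype S] [DecidableEq S] (M : FaceModel S)
    {L : ℕ} (hL : 0 < L) (u : Fin L → ℂ) {N : ℕ} (x : Fin N → ℂ) {α β : Fin (N + 1) → S}
    (h : ¬ ∀ i : Fin N, M.Adj (α i.castSucc) (α i.succ) ∧ M.Adj (β i.castSucc) (β i.succ)) :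
    M.rowsOf u x α β = 0 := by
  obtain ⟨i, hi⟩ := not_forall.mp h
  refine List.prod_eq_zero ((List.mem_ofFn' _ _).mpr ⟨i, ?_⟩)
  exact row_eq_zero_of_not_adj M hL u (x i) hi

open Matrix in
theorem Eigenstate.rowsOf_mulVec_ket_of_ne {S : Type*} [Fintype S] [DecidableEq S]
    {M : FaceModel S} {L : ℕ} {u : Fin L → ℂ} (Φ : M.Eigenstate u) {N : ℕ}
    (x : Fin (N + 1) → ℂ) {α β : Fin (N + 2) → S} (h : α (Fin.last _) ≠ β (Fin.last _)) :
    M.rowsOf u x α β *ᵥ Φ.ket = 0 := by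
  induction N with
  | zero =>
    rw [rowsOf_succ, rowsOf, List.ofFn_zero, List.prod_nil, mul_one]
    exact Φ.row_mulVec_ket_of_ne _ _ _ h
  | succ N ih =>
    rw [rowsOf_succ, ← mulVec_mulVec, ih (Fin.tail x) h, mulVec_zero]

/-- The coefficient with which the operator `M.opA` weights a matrix element, without the
normalization and the Kronecker deltas in the heights `α`, `β`. -/
noncomputable def opACoeff {S : Type*} [DecidableEq S] (M : FaceModel S) (lam : ℂ) {n : ℕ}
    (x : Fin (n + 1) → ℂ) (α β γ δ : Fin (n + 2) → S) : ℂ :=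
  (if α (Fin.last n).castSucc = γ (Fin.last (n + 1)) then 1 else 0) *
    (∏ i : Fin n, M.W (γ i.castSucc.castSucc) (γ i.castSucc.succ)
      (α i.castSucc.castSucc) (α i.castSucc.succ) (x (Fin.last n) - x i.castSucc)) *
    (∏ i : Fin n, M.W (δ i.castSucc.castSucc) (β i.castSucc.castSucc)
      (δ i.castSucc.succ) (β i.castSucc.succ) (x i.castSucc - x (Fin.last n))) *
    M.W (δ (Fin.last n).castSucc) (β (Fin.last n).castSucc)
      (δ (Fin.last (n + 1))) (β (Fin.last (n + 1))) lam

theorem opACoeff_succ {S : Type*} [DecidableEq S] (M : FaceModel S) (lam : ℂ) {n : ℕ}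
    (x : Fin (n + 2) → ℂ) (α β γ δ : Fin (n + 3) → S) :
    M.opACoeff lam x α β γ δ =
      M.W (γ 0) (γ 1) (α 0) (α 1) (x (Fin.last _) - x 0) *
        M.W (δ 0) (β 0) (δ 1) (β 1) (x 0 - x (Fin.last _)) *
        M.opACoeff lam (Fin.tail x) (Fin.tail (α := fun _ => S) α) (Fin.tail (α := fun _ => S) β)
          (Fin.tail (α := fun _ => S) γ) (Fin.tail (α := fun _ => S) δ) := by
  rw [opACoeff, Fin.prod_univ_succ, Fin.prod_univ_succ]
  have h : M.opACoeff lam (Fin.tail x) (Fin.tail (α := fun _ => S) α)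
      (Fin.tail (α := fun _ => S) β) (Fin.tail (α := fun _ => S) γ)
      (Fin.tail (α := fun _ => S) δ) =
    (if α (Fin.last (n + 1)).castSucc = γ (Fin.last (n + 2)) then 1 else 0) *
    (∏ i : Fin n, M.W (γ i.succ.castSucc.castSucc) (γ i.succ.castSucc.succ)
      (α i.succ.castSucc.castSucc) (α i.succ.castSucc.succ)
      (x (Fin.last (n + 1)) - x i.succ.castSucc)) *
    (∏ i : Fin n, M.W (δ i.succ.castSucc.castSucc) (β i.succ.castSucc.castSucc)
      (δ i.succ.castSucc.succ) (β i.succ.castSucc.succ)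
      (x i.succ.castSucc - x (Fin.last (n + 1)))) *
    M.W (δ (Fin.last (n + 1)).castSucc) (β (Fin.last (n + 1)).castSucc)
      (δ (Fin.last (n + 2))) (β (Fin.last (n + 2))) lam := rfl
  rw [h]
  simp only [Fin.castSucc_zero, Fin.succ_zero_eq_one]
  ring

/-- A row is moved through another one by the Yang–Baxter equation and the auxiliary faces on the
right are removed by unitarity. -/
theorem IsIntegrable.sum_W_smul_row_mul_row {S : Type*} [Fintype S] [DecidableEq S]
    {M : FaceModel S} {ρ : ℂ → ℂ} {lam : ℂ} (hM : M.IsIntegrable ρ lam) {L : ℕ} (hL : 0 < L)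
    (u : Fin L → ℂ) (g d α₀ β₀ α₁ β₁ : S) (hβ : M.Adj β₀ β₁) (x z : ℂ) :
    ∑ g', ∑ d', (M.W g g' α₀ α₁ (z - x) * M.W d β₀ d' β₁ (x - z)) •
        (M.row u g d g' d' x * M.row u g' d' α₁ β₁ z) =
      (ρ (x - z) * ρ (z - x)) • (M.row u g d α₀ β₀ z * M.row u α₀ β₀ α₁ β₁ x) := by
  have h1 : ∀ d', ∑ g', (M.W g g' α₀ α₁ (z - x) * M.W d β₀ d' β₁ (x - z)) •
        (M.row u g d g' d' x * M.row u g' d' α₁ β₁ z) =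
      ∑ e, (M.W d d' e β₁ (z - x) * M.W d β₀ d' β₁ (x - z)) •
        (M.row u g d α₀ e z * M.row u α₀ e α₁ β₁ x) := by
    intro d'
    simp only [mul_comm _ (M.W d β₀ d' β₁ (x - z)), mul_smul, ← Finset.smul_sum]
    rw [hM.row_exchange]
  rw [Finset.sum_comm, Finset.sum_congr rfl fun d' _ => h1 d', Finset.sum_comm]
  simp only [← Finset.sum_smul]
  -- Unitarity is available only for adjacent heights; in the remaining cases a row or a weight
  -- vanishes.
  have h2 : ∀ e, e ≠ β₀ → (∑ d', M.W d d' e β₁ (z - x) * M.W d β₀ d' β₁ (x - z)) •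
      (M.row u g d α₀ e z * M.row u α₀ e α₁ β₁ x) = 0 := by
    intro e he
    by_cases hde : M.Adj d e
    · by_cases heb : M.Adj e β₁
      · by_cases hdb : M.Adj d β₀
        · have := hM.unitarity _ _ _ _ (z - x) hde heb hdb hβ
          rw [neg_sub, if_neg he, mul_zero] at this
          rw [this, zero_smul]
        · rw [Finset.sum_eq_zero, zero_smul]
          intro d' _
          rw [M.W_eq_zero d β₀ d' β₁ _ fun h => hdb h.1, mul_zero]
      · rw [row_eq_zero_of_not_adj M hL u x (p := α₀) fun h => heb h.2, mul_zero, smul_zero]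
    · rw [row_eq_zero_of_not_adj M hL u z (p := g) fun h => hde h.2, zero_mul, smul_zero]
  rw [Finset.sum_eq_single β₀ (fun e _ => h2 e) (by simp)]
  by_cases hdb : M.Adj d β₀
  · have := hM.unitarity _ _ _ _ (z - x) hdb hβ hdb hβ
    rw [neg_sub, if_pos rfl, mul_one] at this
    rw [this, mul_comm]
  · rw [row_eq_zero_of_not_adj M hL u z (p := g) fun h => hdb h.2, zero_mul, smul_zero, smul_zero]

-- The top heights `g`, `d` stay free so that induction can peel off the first site. `hbase`
-- isolates the bottom step, the only place where the two cases of the theorem differ; `K` stands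
-- for the eigenvalue at `z + lam`.
open Matrix in
theorem IsIntegrable.sum_opACoeff_smul_rowsOf_mulVec {S : Type*} [Fintype S] [DecidableEq S]
    {M : FaceModel S} {ρ : ℂ → ℂ} {lam : ℂ} (hM : M.IsIntegrable ρ lam) {L : ℕ} (hL : 0 < L)
    {u : Fin L → ℂ} (Φ : M.Eigenstate u) (z K : ℂ) {n : ℕ} (x y : Fin (n + 1) → ℂ)
    (α β : Fin (n + 2) → S) (hβ : ∀ i : Fin (n + 1), M.Adj (β i.castSucc) (β i.succ))
    (hx : x (Fin.last n) = z) (hy : ∀ i : Fin n, y i.castSucc = x i.castSucc)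
    (hbase : ∀ g d, (K * M.W d (β (Fin.last n).castSucc) (α (Fin.last n).castSucc)
        (β (Fin.last (n + 1))) lam) •
        M.row u g d (α (Fin.last n).castSucc) (α (Fin.last n).castSucc) z *ᵥ Φ.ket =
      (M.row u g d (α (Fin.last n).castSucc) (β (Fin.last n).castSucc) z *
        M.row u (α (Fin.last n).castSucc) (β (Fin.last n).castSucc) (α (Fin.last (n + 1)))
          (β (Fin.last (n + 1))) (y (Fin.last n))) *ᵥ Φ.ket) (g d : S) :
    K • ∑ γ : Fin (n + 1) → S, ∑ δ : Fin (n + 1) → S,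
        M.opACoeff lam x α β (Fin.cons (α := fun _ => S) g γ) (Fin.cons (α := fun _ => S) d δ) •
          M.rowsOf u x (Fin.cons (α := fun _ => S) g γ) (Fin.cons (α := fun _ => S) d δ) *ᵥ
            Φ.ket =
      (∏ i : Fin n, ρ (x i.castSucc - z) * ρ (z - x i.castSucc)) •
        M.row u g d (α 0) (β 0) z *ᵥ (M.rowsOf u y α β *ᵥ Φ.ket) := by
  induction n generalizing g d with
  | zero =>
    have hz : x 0 = z := hx
    have hb := hbase g d
    have e1 : Fin.last (0 + 1) = 1 := rfl
    simp only [Fin.last_zero, Fin.castSucc_zero, e1] at hb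
    have e : ∀ f : Fin 1 → S, f 0 = (Equiv.funUnique (Fin 1) S) f := fun _ => rfl
    have e' : ∀ (g : S) (γ : Fin 1 → S), (Fin.cons (α := fun _ => S) g γ : Fin 2 → S) 1 = γ 0 :=
      fun g γ => rfl
    simp only [rowsOf_succ, opACoeff, Fin.prod_univ_zero, Fin.cons_zero, Fin.last_zero,
      Fin.castSucc_zero, e1, one_smul, mul_one, e']
    simp only [rowsOf, List.ofFn_zero, List.prod_nil, mul_one]
    simp only [e]
    rw [(Equiv.funUnique (Fin 1) S).sum_comp fun g' => ∑ δ : Fin 1 → S,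
      ((if α 0 = g' then (1 : ℂ) else 0) * M.W d (β 0) (Equiv.funUnique (Fin 1) S δ) (β 1) lam) •
        M.row u g d g' (Equiv.funUnique (Fin 1) S δ) (x 0) *ᵥ Φ.ket]
    rw [Finset.sum_congr rfl fun g' _ => (Equiv.funUnique (Fin 1) S).sum_comp fun d' =>
      ((if α 0 = g' then (1 : ℂ) else 0) * M.W d (β 0) d' (β 1) lam) •
        M.row u g d g' d' (x 0) *ᵥ Φ.ket]
    -- The delta in `opACoeff` fixes the last height of `γ`; periodicity of `Φ.ket` then forces the
    -- same value for `δ`.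
    rw [Finset.sum_eq_single (α 0), Finset.sum_eq_single (α 0)]
    · rw [if_pos rfl, one_mul, smul_smul, hz, hb, mulVec_mulVec]
    · intro d' _ hd'
      rw [Φ.row_mulVec_ket_of_ne _ _ _ (Ne.symm hd'), smul_zero]
    · simp
    · intro g' _ hg'
      simp [Ne.symm hg']
    · simp
  | succ n ih =>
    have IH := ih (Fin.tail x) (Fin.tail y) (Fin.tail (α := fun _ => S) α)
      (Fin.tail (α := fun _ => S) β) (fun i => hβ i.succ) hx (fun i => hy i.succ) hbase
    set v := M.rowsOf u (Fin.tail y) (Fin.tail (α := fun _ => S) α)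
      (Fin.tail (α := fun _ => S) β) *ᵥ Φ.ket with hv
    have e' : ∀ (g g' : S) (γ : Fin (n + 1) → S), (Fin.cons (α := fun _ => S) g
      (Fin.cons (α := fun _ => S) g' γ : Fin (n + 2) → S) : Fin (n + 3) → S) 1 = g' :=
      fun g g' γ => rfl
    have hα1 : Fin.tail (α := fun _ => S) α 0 = α 1 := rfl
    have hβ1 : Fin.tail (α := fun _ => S) β 0 = β 1 := rfl
    have hy0 : y 0 = x 0 := hy 0
    set C := ∏ i : Fin n, ρ ((Fin.tail x : Fin (n + 1) → ℂ) i.castSucc - z) *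
      ρ (z - (Fin.tail x : Fin (n + 1) → ℂ) i.castSucc) with hC
    have hprod : (∏ i : Fin (n + 1), ρ (x i.castSucc - z) * ρ (z - x i.castSucc)) =
        ρ (x 0 - z) * ρ (z - x 0) * C := by
      rw [Fin.prod_univ_succ]
      rfl
    rw [hprod, rowsOf_succ M u y, ← mulVec_mulVec, ← hv, hy0]
    -- Used from right to left: below the row at `x 0` appears the row at `z` acting on `v`, which
    -- is the right-hand side of the induction hypothesis.
    have hex := congrArg (fun A => (C • A) *ᵥ v) (hM.sum_W_smul_row_mul_row hL u g d (α 0) (β 0)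
      (α 1) (β 1) (hβ 0) (x 0) z)
    simp only [Finset.smul_sum, sum_mulVec, smul_mulVec] at hex
    rw [mul_comm, mul_smul, mulVec_mulVec, ← hex, sum_cons, Finset.smul_sum]
    refine Finset.sum_congr rfl fun g' _ => ?_
    simp only [sum_cons (k := n + 1)]
    rw [Finset.sum_comm, Finset.smul_sum]
    refine Finset.sum_congr rfl fun d' _ => ?_
    have IH' := IH g' d'
    rw [hα1, hβ1] at IH'
    rw [smul_comm C, ← mulVec_mulVec, ← mulVec_smul, ← IH']
    simp only [opACoeff_succ, rowsOf_succ M u x, Fin.tail_cons, Fin.cons_zero, e', mul_smul,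
      ← mulVec_mulVec, hx, mulVec_smul, mulVec_sum, Finset.smul_sum]
    refine Finset.sum_congr rfl fun γ _ => Finset.sum_congr rfl fun δ _ => ?_
    simp only [smul_smul]
    congr 1
    ring

/-! ### Contraction with the left eigenvector and normalization. -/

open Matrix in
theorem IsIntegrable.opA_density_apply {S : Type*} [Fintype S] [DecidableEq S]
    {M : FaceModel S} {ρ : ℂ → ℂ} {lam : ℂ} (hM : M.IsIntegrable ρ lam) {L : ℕ} (hL : 0 < L)
    {u : Fin L → ℂ} (Φ : M.Eigenstate u) {n : ℕ} (x : Fin (n + 1) → ℂ)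
    (hρ : ∀ i, ρ (x i - x (Fin.last n)) ≠ 0 ∧ ρ (x (Fin.last n) - x i) ≠ 0)
    (hΛ : ∀ i, Φ.eigenvalue (x i) ≠ 0)
    (hΛ' : Φ.eigenvalue (x (Fin.last n) + lam) ≠ 0) (α β : M.Path (n + 1))
    (hbase : α.1 (Fin.last (n + 1)) = β.1 (Fin.last (n + 1)) → ∀ g d,
      (Φ.eigenvalue (x (Fin.last n) + lam) * M.W d (β.1 (Fin.last n).castSucc)
          (α.1 (Fin.last n).castSucc) (β.1 (Fin.last (n + 1))) lam) •
        M.row u g d (α.1 (Fin.last n).castSucc) (α.1 (Fin.last n).castSucc) (x (Fin.last n)) *ᵥ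
          Φ.ket =
      (M.row u g d (α.1 (Fin.last n).castSucc) (β.1 (Fin.last n).castSucc) (x (Fin.last n)) *
        M.row u (α.1 (Fin.last n).castSucc) (β.1 (Fin.last n).castSucc)
          (β.1 (Fin.last (n + 1))) (β.1 (Fin.last (n + 1))) (x (Fin.last n) + lam)) *ᵥ Φ.ket) :
    M.opA ρ lam x (M.density u Φ x) α β =
      M.density u Φ (Function.update x (Fin.last n) (x (Fin.last n) + lam)) α β := by
  set z := x (Fin.last n) with hz
  set y := Function.update x (Fin.last n) (z + lam) with hy
  have hrhs : M.density u Φ y α β = (Φ.bra ⬝ᵥ M.rowsOf u y α.1 β.1 *ᵥ Φ.ket) /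
      ((Φ.bra ⬝ᵥ Φ.ket) * ∏ k, Φ.eigenvalue (y k)) := rfl
  have hlhs : M.opA ρ lam x (M.density u Φ x) α β =
      ((if α.1 0 = β.1 0 then 1 else 0) *
        (if α.1 (Fin.last (n + 1)) = β.1 (Fin.last (n + 1)) then 1 else 0)) /
      (∏ i : Fin (n + 1), ρ (x i - z) * ρ (z - x i)) *
      ∑ γ : M.Path (n + 1), ∑ δ : M.Path (n + 1), M.opACoeff lam x α.1 β.1 γ.1 δ.1 *
        ((Φ.bra ⬝ᵥ M.rowsOf u x γ.1 δ.1 *ᵥ Φ.ket) /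
          ((Φ.bra ⬝ᵥ Φ.ket) * ∏ k, Φ.eigenvalue (x k))) := by
    simp only [opA, LinearMap.coe_mk, AddHom.coe_mk, of_apply]
    congr 1
    refine Finset.sum_congr rfl fun γ _ => Finset.sum_congr rfl fun δ _ => ?_
    rw [opACoeff]
    change _ * ((Φ.bra ⬝ᵥ M.rowsOf u x γ.1 δ.1 *ᵥ Φ.ket) /
          ((Φ.bra ⬝ᵥ Φ.ket) * ∏ k, Φ.eigenvalue (x k))) * _ * _ = _
    ring
  rw [hlhs, hrhs]
  by_cases h0 : α.1 0 = β.1 0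
  swap
  · rw [rowsOf_succ, ← mulVec_mulVec, dotProduct_mulVec, Φ.bra_vecMul_row_of_ne _ _ _ h0]
    simp [h0]
  by_cases hN : α.1 (Fin.last (n + 1)) = β.1 (Fin.last (n + 1))
  swap
  · rw [Φ.rowsOf_mulVec_ket_of_ne y hN]
    simp [hN]
  rw [if_pos h0, if_pos hN]
  -- The identity with denominators cleared: one eigenvalue comes from `Φ.ket` at the bottom, the
  -- other from `Φ.bra` at the top.
  have hsum : Φ.eigenvalue (z + lam) * ∑ γ : M.Path (n + 1), ∑ δ : M.Path (n + 1),
      M.opACoeff lam x α.1 β.1 γ.1 δ.1 * (Φ.bra ⬝ᵥ M.rowsOf u x γ.1 δ.1 *ᵥ Φ.ket) =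
      (∏ i : Fin n, ρ (x i.castSucc - z) * ρ (z - x i.castSucc)) *
        (Φ.eigenvalue z * (Φ.bra ⬝ᵥ M.rowsOf u y α.1 β.1 *ᵥ Φ.ket)) := by
    have hmain := hM.sum_opACoeff_smul_rowsOf_mulVec hL Φ z (Φ.eigenvalue (z + lam)) x y α.1 β.1
      β.2 rfl (fun i => Function.update_of_ne (Fin.castSucc_lt_last i).ne _ _)
      (by rw [hN, hy, Function.update_self]; exact hbase hN)
    have hpath : ∀ (γ δ : Fin (n + 2) → S),
        (¬ ∀ i : Fin (n + 1), M.Adj (γ i.castSucc) (γ i.succ) ∧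
          M.Adj (δ i.castSucc) (δ i.succ)) →
        M.opACoeff lam x α.1 β.1 γ δ * (Φ.bra ⬝ᵥ M.rowsOf u x γ δ *ᵥ Φ.ket) = 0 := by
      intro γ δ h
      rw [rowsOf_eq_zero_of_not_path M hL u x h, zero_mulVec, dotProduct_zero, mul_zero]
    have hδ : ∀ γ : Fin (n + 2) → S, (∑ δ : M.Path (n + 1),
        M.opACoeff lam x α.1 β.1 γ δ.1 * (Φ.bra ⬝ᵥ M.rowsOf u x γ δ.1 *ᵥ Φ.ket)) =
        ∑ δ, M.opACoeff lam x α.1 β.1 γ δ * (Φ.bra ⬝ᵥ M.rowsOf u x γ δ *ᵥ Φ.ket) := fun γ =>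
      sum_path M (fun δ => M.opACoeff lam x α.1 β.1 γ δ *
        (Φ.bra ⬝ᵥ M.rowsOf u x γ δ *ᵥ Φ.ket)) fun δ h => hpath γ δ fun h' => h fun i => (h' i).2
    simp only [hδ]
    rw [sum_path M (fun γ => ∑ δ, M.opACoeff lam x α.1 β.1 γ δ *
        (Φ.bra ⬝ᵥ M.rowsOf u x γ δ *ᵥ Φ.ket)) fun γ h => Finset.sum_eq_zero fun δ _ =>
          hpath γ δ fun h' => h fun i => (h' i).1]
    rw [sum_cons]
    simp only [sum_cons (k := n + 1)]
    have hgd : ∀ g d, Φ.eigenvalue (z + lam) * ∑ γ : Fin (n + 1) → S, ∑ δ : Fin (n + 1) → S,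
        M.opACoeff lam x α.1 β.1 (Fin.cons (α := fun _ => S) g γ)
          (Fin.cons (α := fun _ => S) d δ) * (Φ.bra ⬝ᵥ M.rowsOf u x
            (Fin.cons (α := fun _ => S) g γ) (Fin.cons (α := fun _ => S) d δ) *ᵥ Φ.ket) =
        (∏ i : Fin n, ρ (x i.castSucc - z) * ρ (z - x i.castSucc)) *
          (Φ.bra ⬝ᵥ M.row u g d (α.1 0) (β.1 0) z *ᵥ (M.rowsOf u y α.1 β.1 *ᵥ Φ.ket)) := by
      intro g d
      have := congrArg (Φ.bra ⬝ᵥ ·) (hmain g d)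
      simpa only [dotProduct_smul, dotProduct_sum, smul_eq_mul] using this
    have hdiag : ∀ g d, g ≠ d →
        Φ.bra ⬝ᵥ M.row u g d (α.1 0) (β.1 0) z *ᵥ (M.rowsOf u y α.1 β.1 *ᵥ Φ.ket) = 0 := by
      intro g d h
      rw [dotProduct_mulVec, Φ.bra_vecMul_row_of_ne _ _ _ h, zero_dotProduct]
    rw [Finset.sum_congr rfl fun g _ => Finset.sum_comm]
    simp only [Finset.mul_sum (s := (Finset.univ : Finset S))]
    simp only [hgd]
    rw [Finset.sum_congr rfl fun g _ => Finset.sum_eq_single g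
      (fun d _ hd => by rw [hdiag g d (Ne.symm hd), mul_zero]) (by simp), ← Finset.mul_sum]
    congr 1
    rw [rowsOf_succ, ← mulVec_mulVec, ← h0]
    simp only [mulVec_mulVec (M.rowsOf u _ _ _ *ᵥ Φ.ket)]
    exact Φ.sum_bra_row_mul_row _ _ _ _ _ _
  simp only [← mul_div_assoc, ← Finset.sum_div]
  -- The last site contributes `ρ 0 ^ 2 = 1`, although the row at `z` passes only the `n` others.
  have hP : (∏ i : Fin (n + 1), ρ (x i - z) * ρ (z - x i)) =
      ∏ i : Fin n, ρ (x i.castSucc - z) * ρ (z - x i.castSucc) := by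
    rw [Fin.prod_univ_castSucc, ← hz, sub_self, ← sq, hM.rho_zero, mul_one]
  have hP0 : (∏ i : Fin n, ρ (x i.castSucc - z) * ρ (z - x i.castSucc)) ≠ 0 :=
    Finset.prod_ne_zero_iff.mpr fun i _ => mul_ne_zero (hρ i.castSucc).1 (hρ i.castSucc).2
  have hL1 : (∏ k, Φ.eigenvalue (x k)) =
      (∏ k : Fin n, Φ.eigenvalue (x k.castSucc)) * Φ.eigenvalue z := Fin.prod_univ_castSucc _
  have hL2 : (∏ k, Φ.eigenvalue (y k)) =
      (∏ k : Fin n, Φ.eigenvalue (x k.castSucc)) * Φ.eigenvalue (z + lam) := by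
    rw [Fin.prod_univ_castSucc, hy, Function.update_self]
    congr 1
    exact Finset.prod_congr rfl fun i _ => by
      rw [Function.update_of_ne (Fin.castSucc_lt_last i).ne]
  have hL0 : (∏ k : Fin n, Φ.eigenvalue (x k.castSucc)) ≠ 0 :=
    Finset.prod_ne_zero_iff.mpr fun i _ => hΛ _
  have hz0 : Φ.eigenvalue z ≠ 0 := hΛ _
  have hpair := Φ.pairing_ne_zero
  rw [hP, hL1, hL2]
  field_simp
  linear_combination hsum

end FaceModel

theorem theorem2 {S : Type*} [Fintype S] [DecidableEq S] (M : FaceModel S)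
    (ρ : ℂ → ℂ) (lam : ℂ) (hM : M.IsIntegrable ρ lam)
    {L : ℕ} (hL : 0 < L) (u : Fin L → ℂ) (Φ : M.Eigenstate u)
    {n : ℕ} (x : Fin (n + 1) → ℂ)
    (hρ : ∀ i, ρ (x i - x (Fin.last n)) ≠ 0 ∧ ρ (x (Fin.last n) - x i) ≠ 0)
    (hΛ : ∀ i, Φ.eigenvalue (x i) ≠ 0)
    (hΛ' : Φ.eigenvalue (x (Fin.last n) + lam) ≠ 0) :
    ((∃ i : Fin L, x (Fin.last n) = u i) →
      M.opA ρ lam x (M.density u Φ x) =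
        M.density u Φ (Function.update x (Fin.last n) (x (Fin.last n) + lam))) ∧
    (∀ α β : M.Path (n + 1),
      (∃! s : S, M.Adj (α.1 (Fin.last n).castSucc) s) →
      α.1 (Fin.last n).castSucc = β.1 (Fin.last n).castSucc →
      M.opA ρ lam x (M.density u Φ x) α β =
        M.density u Φ (Function.update x (Fin.last n) (x (Fin.last n) + lam)) α β) := by
  refine ⟨fun ⟨i, hi⟩ => ?_, fun α β hleaf hαβ => ?_⟩
  · ext α β
    refine hM.opA_density_apply hL Φ x hρ hΛ hΛ' α β fun hN => ?_
    rw [hi]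
    refine hM.row_mul_row_mulVec_ket_of_inhomogeneity Φ i ?_ (β.2 (Fin.last n))
    have := α.2 (Fin.last n)
    rwa [Fin.succ_last, hN] at this
  · refine hM.opA_density_apply hL Φ x hρ hΛ hΛ' α β fun _ => ?_
    have hadj : M.Adj (β.1 (Fin.last n).castSucc) (β.1 (Fin.last (n + 1))) := β.2 (Fin.last n)
    rw [← hαβ] at hadj ⊢
    exact hM.row_mul_row_mulVec_ket_of_leaf hL Φ _ hadj fun s hs => hleaf.unique hs hadj
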